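/- Let $k\ge 3$ and let $\mathcal L$ be a set of straight lines in $\mathbb R^d$ (for instance in the plane) in general position, i.e. no three distinct lines of $\mathcal L$ share a common point. Let $\mathcal P$ be a set of points such that every line of $\mathcal L$ contains exactly $k$ points of $\mathcal P$. Put $$R_k = 1+\left\lfloor \frac{k-1}{k-2}\,(4k^2-8k)^{1/(k-1)}\right\rfloor ,$$ and let every point $p\in\mathcal P$ have a list $L_p$ of at least $R_k$ colors. Then one can choose a color $c(p)\in L_p$ for each $p\in\mathcal P$ so that any two distinct lines of $\mathcal L$ that share a point of $\mathcal P$ have different sequences of colors, whichever direction is chosen along each of the two lines; here the sequence of colors of a line $\ell$ in a given direction is $(c(p_1),\dots,c(p_k))$, where $p_1,\dots,p_k$ are the points of $\mathcal P\cap\ell$ in the order in which they are met along $\ell$ in that direction. Moreover, $R_k=2$ for every $k\ge 12$. -/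

import Mathlib

namespace LineColoring

/-- A straight line of `ℝ^d`. -/
def IsLine {d : ℕ} (l : AffineSubspace ℝ (EuclideanSpace ℝ (Fin d))) : Prop :=
  (l : Set (EuclideanSpace ℝ (Fin d))).Nonempty ∧ Module.finrank ℝ l.direction = 1

/-- No three distinct members of `𝓛` share a common point. -/
def InGeneralPosition {d : ℕ} (𝓛 : Set (AffineSubspace ℝ (EuclideanSpace ℝ (Fin d)))) : Prop :=
  ∀ l₁ ∈ 𝓛, ∀ l₂ ∈ 𝓛, ∀ l₃ ∈ 𝓛, l₁ ≠ l₂ → l₁ ≠ l₃ → l₂ ≠ l₃ →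
    ¬ ∃ x : EuclideanSpace ℝ (Fin d), x ∈ l₁ ∧ x ∈ l₂ ∧ x ∈ l₃

/-- `p` lists all the points of `𝓟` on `l`, each exactly once, in the order in which they are met
when `l` is traversed in one of its two directions (the direction of the vector `v`). -/
def IsTraversal {d k : ℕ} (𝓟 : Set (EuclideanSpace ℝ (Fin d)))
    (l : AffineSubspace ℝ (EuclideanSpace ℝ (Fin d))) (p : Fin k → 𝓟) : Prop :=
  Set.range (fun i => (p i : EuclideanSpace ℝ (Fin d))) = 𝓟 ∩ l ∧
    ∃ (a v : EuclideanSpace ℝ (Fin d)) (t : Fin k → ℝ),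
      v ≠ 0 ∧ StrictMono t ∧ ∀ i, (p i : EuclideanSpace ℝ (Fin d)) = a + t i • v

/-- The lines `l` and `m`, each with `k` points of `𝓟`, have the same sequence of colors under `c`
for some choice of a direction along each of them. -/
def SameColorSequence {d : ℕ} {C : Type*} (k : ℕ) (𝓟 : Set (EuclideanSpace ℝ (Fin d)))
    (c : 𝓟 → C) (l m : AffineSubspace ℝ (EuclideanSpace ℝ (Fin d))) : Prop :=
  ∃ p q : Fin k → 𝓟, IsTraversal 𝓟 l p ∧ IsTraversal 𝓟 m q ∧ ∀ i, c (p i) = c (q i)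

/-- The number `1 + ⌊(k-1)/(k-2) * (4k² - 8k)^(1/(k-1))⌋`, meaningful for `k ≥ 3`. -/
noncomputable def listBound (k : ℕ) : ℕ :=
  1 + ⌊((k : ℝ) - 1) / ((k : ℝ) - 2) *
    (4 * (k : ℝ) ^ 2 - 8 * (k : ℝ)) ^ (1 / ((k : ℝ) - 1))⌋₊

end LineColoring

/-- A family of patterns, each of which depends on the colors of finitely many (and at least one)
vertices. -/
structure PatternFamily (ι V C : Type*) where
  /-- The vertices on which a pattern depends. -/
  supp : ι → Set V
  /-- The pattern occurs in a coloring. -/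
  Occurs : ι → (V → C) → Prop
  finite_supp : ∀ e, (supp e).Finite
  nonempty_supp : ∀ e c, Occurs e c → (supp e).Nonempty
  congr : ∀ e c c', Set.EqOn c c' (supp e) → Occurs e c → Occurs e c'

namespace PatternFamily

variable {ι V C : Type*} (F : PatternFamily ι V C)

/-- On the vertices of `T`, a coloring in which `e` occurs is determined by its values
elsewhere. -/
def Determines (e : ι) (T : Finset V) : Prop :=
  ∀ c c', F.Occurs e c → F.Occurs e c' → Set.EqOn c c' (↑T)ᶜ → c = c'

/-- The colorings of `S` from the lists `L` that avoid every pattern inside `S`, extended by `d`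
outside `S`. -/
def avoiding (L : V → Finset C) (d : V → C) (S : Finset V) : Set (V → C) :=
  {c | (∀ v ∈ S, c v ∈ L v) ∧ (∀ v ∉ S, c v = d v) ∧ ∀ e, F.supp e ⊆ S → ¬ F.Occurs e c}

lemma finite_listColorings (L : V → Finset C) (d : V → C) (S : Finset V) :
    {c : V → C | (∀ v ∈ S, c v ∈ L v) ∧ ∀ v ∉ S, c v = d v}.Finite := by
  classical
  refine Set.Finite.of_injOn (f := fun c (v : S) => c v)
    (t := (Fintype.piFinset fun v : S => L v : Finset (S → C))) ?_ ?_ (Finset.finite_toSet _)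
  · intro c hc
    simp only [Finset.mem_coe, Fintype.mem_piFinset]
    exact fun v => hc.1 v v.2
  · intro c hc c' hc' h
    funext v
    by_cases hv : v ∈ S
    · exact congrFun h ⟨v, hv⟩
    · rw [hc.2 v hv, hc'.2 v hv]

lemma finite_avoiding (L : V → Finset C) (d : V → C) (S : Finset V) :
    (F.avoiding L d S).Finite :=
  (finite_listColorings L d S).subset fun _ hc => ⟨hc.1, hc.2.1⟩

lemma avoiding_empty (L : V → Finset C) (d : V → C) : F.avoiding L d ∅ = {d} := by
  ext c
  simp only [avoiding, Set.mem_ofPred_eq, Set.mem_singleton_iff]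
  constructor
  · exact fun h => funext fun v => h.2.1 v (by simp)
  · rintro rfl
    refine ⟨by simp, fun _ _ => rfl, fun e he h => ?_⟩
    obtain ⟨v, hv⟩ := F.nonempty_supp e c h
    simpa using he hv

/-- Colorings of `insert v S` in which `e` occurs are determined off `T`. -/
lemma ncard_occurs_le [DecidableEq V] (L : V → Finset C) (d : V → C) (S : Finset V) (v : V)
    (e : ι) (T : Finset V) (hv : v ∈ T) (hT : F.Determines e T) :
    {c | F.Occurs e c ∧ ∃ c₀ ∈ F.avoiding L d S, ∃ a ∈ L v, c = Function.update c₀ v a}.ncard ≤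
      (F.avoiding L d (S \ T)).ncard := by
  refine Set.ncard_le_ncard_of_injOn (fun c w => if w ∈ T then d w else c w) ?_ ?_
    (F.finite_avoiding L d _)
  · rintro c ⟨-, c₀, hc₀, a, -, rfl⟩
    have key : ∀ w, w ∉ T → Function.update c₀ v a w = c₀ w := fun w hw =>
      Function.update_of_ne (by rintro rfl; exact hw hv) _ _
    refine ⟨fun w hw => ?_, fun w hw => ?_, fun e' he' h => ?_⟩
    · rw [Finset.mem_sdiff] at hw
      simp only [hw.2, if_false, key w hw.2]
      exact hc₀.1 w hw.1
    · by_cases hwT : w ∈ T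
      · simp [hwT]
      · simp only [hwT, if_false, key w hwT]
        exact hc₀.2.1 w fun h => hw (Finset.mem_sdiff.2 ⟨h, hwT⟩)
    · refine hc₀.2.2 e' (fun w hw => (Finset.mem_sdiff.1 (he' hw)).1) (F.congr e' _ _ ?_ h)
      intro w hw
      have hwT := (Finset.mem_sdiff.1 (he' hw)).2
      simp only [hwT, if_false, key w hwT]
  · rintro c ⟨hc, -⟩ c' ⟨hc', -⟩ h
    refine hT c c' hc hc' fun w hw => ?_
    have := congrFun h w
    have hwT : w ∉ T := hw
    simpa [hwT] using this

lemma ncard_extensions [DecidableEq V] (L : V → Finset C) (d : V → C) (S : Finset V) (v : V)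
    (hv : v ∉ S) :
    {c | ∃ c₀ ∈ F.avoiding L d S, ∃ a ∈ L v, c = Function.update c₀ v a}.ncard =
      (F.avoiding L d S).ncard * (L v).card := by
  have : {c | ∃ c₀ ∈ F.avoiding L d S, ∃ a ∈ L v, c = Function.update c₀ v a} =
      (fun x : (V → C) × C => Function.update x.1 v x.2) '' (F.avoiding L d S ×ˢ (L v : Set C)) := by
    ext c
    constructor
    · rintro ⟨c₀, h₀, a, ha, rfl⟩
      exact ⟨(c₀, a), ⟨h₀, ha⟩, rfl⟩
    · rintro ⟨⟨c₀, a⟩, ⟨h₀, ha⟩, rfl⟩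
      exact ⟨c₀, h₀, a, ha, rfl⟩
  rw [this, Set.InjOn.ncard_image, Set.ncard_prod, Set.ncard_coe_finset]
  rintro ⟨c, a⟩ ⟨hc, -⟩ ⟨c', a'⟩ ⟨hc', -⟩ h
  have h' : ∀ w, Function.update c v a w = Function.update c' v a' w := congrFun h
  refine Prod.ext (funext fun w => ?_) (by simpa using h' v)
  by_cases hw : w = v
  · subst hw
    exact (hc.2.1 w hv).trans (hc'.2.1 w hv).symm
  · simpa [hw] using h' w

/-- If every pattern through `v` is dominated by one of the patterns in `B v`, each of which
determines the colors on a set of `n + 1` vertices of its support that contains `v`, then a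
coloring of `S` extends to `insert v S` in many ways. -/
lemma mul_ncard_avoiding_le [DecidableEq V] (L : V → Finset C) (d : V → C)
    (B : V → Finset ι) (n : ℕ)
    (hcover : ∀ e v, v ∈ F.supp e → ∃ e' ∈ B v, v ∈ F.supp e' ∧ F.supp e' ⊆ F.supp e ∧
      ∀ c, F.Occurs e c → F.Occurs e' c)
    (hdet : ∀ e v, v ∈ F.supp e → ∃ T : Finset V, v ∈ T ∧ (T : Set V) ⊆ F.supp e ∧
      T.card = n + 1 ∧ F.Determines e T)
    (S : Finset V) (v : V) (hv : v ∉ S) (M : ℝ) (hM : 0 ≤ M)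
    (hbound : ∀ T : Finset V, v ∈ T → T ⊆ insert v S → T.card = n + 1 →
      ((F.avoiding L d (S \ T)).ncard : ℝ) ≤ M) :
    ((F.avoiding L d S).ncard : ℝ) * (L v).card ≤
      (F.avoiding L d (insert v S)).ncard + (B v).card * M := by
  classical
  set B' := (B v).filter fun e => v ∈ F.supp e ∧ F.supp e ⊆ (insert v S : Finset V) with hB'
  set O : ι → Set (V → C) := fun e =>
    {c | F.Occurs e c ∧ ∃ c₀ ∈ F.avoiding L d S, ∃ a ∈ L v, c = Function.update c₀ v a}
  have hfinX : {c | ∃ c₀ ∈ F.avoiding L d S, ∃ a ∈ L v, c = Function.update c₀ v a}.Finite := by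
    refine (finite_listColorings L d (insert v S)).subset ?_
    rintro c ⟨c₀, h₀, a, ha, rfl⟩
    refine ⟨fun w hw => ?_, fun w hw => ?_⟩
    · by_cases hwv : w = v
      · subst hwv; simpa using ha
      · simpa [hwv] using h₀.1 w (by simpa [hwv] using hw)
    · rw [Finset.mem_insert, not_or] at hw
      simpa [hw.1] using h₀.2.1 w hw.2
  have hsub : {c | ∃ c₀ ∈ F.avoiding L d S, ∃ a ∈ L v, c = Function.update c₀ v a} ⊆
      F.avoiding L d (insert v S) ∪ ⋃ e ∈ B', O e := by
    rintro c hc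
    obtain ⟨c₀, h₀, a, ha, hca⟩ := hc
    by_cases hgood : ∀ e, F.supp e ⊆ (insert v S : Finset V) → ¬ F.Occurs e c
    · left
      refine ⟨fun w hw => ?_, fun w hw => ?_, hgood⟩
      · by_cases hwv : w = v
        · subst hwv; simpa [hca] using ha
        · simpa [hca, hwv] using h₀.1 w (by simpa [hwv] using hw)
      · rw [Finset.mem_insert, not_or] at hw
        simpa [hca, hw.1] using h₀.2.1 w hw.2
    · right
      push Not at hgood
      obtain ⟨e, he, hec⟩ := hgood
      have hve : v ∈ F.supp e := by
        by_contra hve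
        refine h₀.2.2 e (fun w hw => ?_) (F.congr e c c₀ (fun w hw => ?_) hec)
        · have hwv : w ≠ v := fun h => hve (h ▸ hw)
          simpa [hwv] using he hw
        · have hwv : w ≠ v := fun h => hve (h ▸ hw)
          simp [hca, hwv]
      obtain ⟨e', he'B, hve', hsub, hocc⟩ := hcover e v hve
      simp only [Set.mem_iUnion]
      exact ⟨e', Finset.mem_filter.2 ⟨he'B, hve', hsub.trans he⟩, hocc c hec, c₀, h₀, a, ha, hca⟩
  have hO : ∀ e ∈ B', ((O e).ncard : ℝ) ≤ M := by
    intro e he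
    obtain ⟨-, hve, hes⟩ := Finset.mem_filter.1 he
    obtain ⟨T, hvT, hTs, hTn, hT⟩ := hdet e v hve
    refine le_trans ?_ (hbound T hvT (fun w hw => hes (hTs hw)) hTn)
    exact Nat.cast_le.2 (F.ncard_occurs_le L d S v e T hvT hT)
  have hfinU : (⋃ e ∈ B', O e).Finite :=
    Set.Finite.biUnion (Finset.finite_toSet _) fun e _ => hfinX.subset fun c hc => hc.2
  have h1 := Set.ncard_le_ncard hsub ((F.finite_avoiding L d _).union hfinU)
  rw [F.ncard_extensions L d S v hv] at h1
  have h2 := h1.trans (Set.ncard_union_le _ _)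
  have h3 : ((⋃ e ∈ B', O e).ncard : ℝ) ≤ (B v).card * M := by
    have h4 : (⋃ e ∈ B', O e).ncard ≤ ∑ e ∈ B', (O e).ncard := Finset.set_ncard_biUnion_le _ _
    calc ((⋃ e ∈ B', O e).ncard : ℝ) ≤ ∑ e ∈ B', ((O e).ncard : ℝ) := by exact_mod_cast h4
      _ ≤ B'.card • M := Finset.sum_le_card_nsmul _ _ _ hO
      _ ≤ (B v).card * M := by
        rw [nsmul_eq_mul]
        gcongr
        exact Finset.filter_subset _ _
  have h5 : ((F.avoiding L d S).ncard : ℝ) * (L v).card ≤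
      (F.avoiding L d (insert v S)).ncard + (⋃ e ∈ B', O e).ncard := by exact_mod_cast h2
  linarith

lemma pow_mul_ncard_avoiding_le [DecidableEq V] (L : V → Finset C) (d : V → C)
    (B : V → Finset ι) (n E r : ℕ) (β : ℝ) (hβ : 0 < β)
    (hL : ∀ v, (L v).card = r) (hE : ∀ v, (B v).card ≤ E)
    (hr : β + E / β ^ n ≤ r)
    (hcover : ∀ e v, v ∈ F.supp e → ∃ e' ∈ B v, v ∈ F.supp e' ∧ F.supp e' ⊆ F.supp e ∧
      ∀ c, F.Occurs e c → F.Occurs e' c)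
    (hdet : ∀ e v, v ∈ F.supp e → ∃ T : Finset V, v ∈ T ∧ (T : Set V) ⊆ F.supp e ∧
      T.card = n + 1 ∧ F.Determines e T) (S : Finset V) :
    ∀ A ⊆ S, β ^ (S \ A).card * (F.avoiding L d A).ncard ≤ (F.avoiding L d S).ncard := by
  induction S using Finset.strongInduction with
  | H S ih =>
    intro A hA
    rcases hA.eq_or_ssubset with rfl | hA'
    · simp
    obtain ⟨v, hvS, hvA⟩ := Finset.exists_of_ssubset hA'
    set S' := S.erase v with hS'
    have hvS' : v ∉ S' := Finset.notMem_erase v S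
    have hins : insert v S' = S := Finset.insert_erase hvS
    have hAS' : A ⊆ S' := fun w hw => Finset.mem_erase.2 ⟨fun h => hvA (h ▸ hw), hA hw⟩
    have ih' := ih S' (Finset.erase_ssubset hvS)
    have hcard : (S \ A).card = (S' \ A).card + 1 := by
      rw [← hins, Finset.insert_sdiff_of_notMem _ hvA, Finset.card_insert_of_notMem]
      simp [hvS']
    set N : ℝ := ((F.avoiding L d S').ncard : ℝ) with hN
    have hN0 : 0 ≤ N := Nat.cast_nonneg _
    have hstep := F.mul_ncard_avoiding_le L d B n hcover hdet S' v hvS' (N / β ^ n)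
      (by positivity) (by
        intro T hvT hTS hTn
        rw [le_div_iff₀ (by positivity), mul_comm]
        have h := ih' (S' \ T) Finset.sdiff_subset
        have hc : (S' \ (S' \ T)).card = n := by
          rw [sdiff_sdiff_right_self]
          have : S' ⊓ T = T.erase v := by
            ext w
            simp only [Finset.inf_eq_inter, Finset.mem_inter, Finset.mem_erase]
            constructor
            · rintro ⟨h1, h2⟩
              exact ⟨fun h => hvS' (h ▸ h1), h2⟩
            · rintro ⟨h1, h2⟩
              exact ⟨by simpa [h1] using hTS h2, h2⟩
          rw [this, Finset.card_erase_of_mem hvT, hTn]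
          rfl
        rwa [hc] at h)
    rw [hL, hins] at hstep
    have hmul : β * N ≤ (F.avoiding L d S).ncard := by
      have h1 : ((B v).card : ℝ) * (N / β ^ n) ≤ E * (N / β ^ n) := by
        gcongr
        exact hE v
      have h2 := mul_le_mul_of_nonneg_left hr hN0
      have h3 : N * (β + E / β ^ n) = β * N + E * (N / β ^ n) := by ring
      linarith
    calc β ^ (S \ A).card * (F.avoiding L d A).ncard
        = β * (β ^ (S' \ A).card * (F.avoiding L d A).ncard) := by rw [hcard, pow_succ]; ring
      _ ≤ β * N := by gcongr; exact ih' A hAS'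
      _ ≤ _ := hmul

/-- Rosenfeld's counting argument for list colorings, with compactness for infinite vertex
sets. -/
theorem exists_listColoring
    (L : V → Finset C) (B : V → Finset ι) (n E r : ℕ) (β : ℝ) (hβ : 0 < β)
    (hL : ∀ v, (L v).card = r) (hE : ∀ v, (B v).card ≤ E)
    (hr : β + E / β ^ n ≤ r)
    (hcover : ∀ e v, v ∈ F.supp e → ∃ e' ∈ B v, v ∈ F.supp e' ∧ F.supp e' ⊆ F.supp e ∧
      ∀ c, F.Occurs e c → F.Occurs e' c)
    (hdet : ∀ e v, v ∈ F.supp e → ∃ T : Finset V, v ∈ T ∧ (T : Set V) ⊆ F.supp e ∧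
      T.card = n + 1 ∧ F.Determines e T) :
    ∃ c : V → C, (∀ v, c v ∈ L v) ∧ ∀ e, ¬ F.Occurs e c := by
  classical
  have hr0 : (0 : ℝ) < r := lt_of_lt_of_le (by positivity) hr
  have hne : ∀ v, (L v).Nonempty := fun v =>
    Finset.card_pos.1 (by rw [hL]; exact_mod_cast hr0)
  choose d hd using hne
  have hfin : ∀ S : Finset V, ∃ c : (v : V) → L v,
      ∀ e, F.supp e ⊆ S → ¬ F.Occurs e fun v => c v := by
    intro S
    have h := F.pow_mul_ncard_avoiding_le L d B n E r β hβ hL hE hr hcover hdet S ∅ (by simp)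
    rw [F.avoiding_empty, Set.ncard_singleton] at h
    have hpos : (0 : ℝ) < (F.avoiding L d S).ncard := lt_of_lt_of_le (by positivity) h
    obtain ⟨c, hc⟩ := Set.nonempty_of_ncard_ne_zero (by exact_mod_cast hpos.ne')
    refine ⟨fun v => ⟨c v, ?_⟩, hc.2.2⟩
    by_cases hv : v ∈ S
    · exact hc.1 v hv
    · rw [hc.2.1 v hv]
      exact hd v
  choose g hg using hfin
  obtain ⟨χ, hχ⟩ := Finset.rado_selection g
  refine ⟨fun v => χ v, fun v => (χ v).2, fun e he => ?_⟩
  obtain ⟨t, hst, ht⟩ := hχ (F.finite_supp e).toFinset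
  refine hg t e (fun v hv => hst (by simpa using hv)) (F.congr e _ _ (fun v hv => ?_) he)
  exact congrArg Subtype.val (ht v (by simpa using hv))

end PatternFamily


namespace LineColoring

/-- The value of `β` that minimizes `β + 4k / β ^ (k - 2)`. -/
noncomputable def growthRate (k : ℕ) : ℝ :=
  (4 * (k : ℝ) ^ 2 - 8 * (k : ℝ)) ^ (1 / ((k : ℝ) - 1))

lemma growthRate_base (m : ℕ) :
    4 * ((m + 2 : ℕ) : ℝ) ^ 2 - 8 * ((m + 2 : ℕ) : ℝ) = 4 * (m + 2) * m := by
  push_cast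
  ring

lemma growthRate_pos {m : ℕ} (hm : 1 ≤ m) : 0 < growthRate (m + 2) := by
  have : (0 : ℝ) < m := by exact_mod_cast hm
  rw [growthRate, growthRate_base]
  positivity

lemma growthRate_pow (m : ℕ) : growthRate (m + 2) ^ (m + 1) = 4 * (m + 2) * m := by
  rw [growthRate, growthRate_base]
  have : (1 : ℝ) / (((m + 2 : ℕ) : ℝ) - 1) = ((m + 1 : ℕ) : ℝ)⁻¹ := by
    rw [one_div]
    congr 1
    push_cast
    ring
  rw [this, Real.rpow_inv_natCast_pow (by positivity) (by omega)]

lemma listBound_eq (m : ℕ) :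
    listBound (m + 2) = 1 + ⌊((m : ℝ) + 1) / m * growthRate (m + 2)⌋₊ := by
  have h1 : ((m + 2 : ℕ) : ℝ) - 1 = m + 1 := by push_cast; ring
  have h2 : ((m + 2 : ℕ) : ℝ) - 2 = m := by push_cast; ring
  rw [listBound, growthRate, h2, h1]

lemma growthRate_add_le_listBound {m : ℕ} (hm : 1 ≤ m) :
    growthRate (m + 2) + ((4 * (m + 2) : ℕ) : ℝ) / growthRate (m + 2) ^ m ≤
      listBound (m + 2) := by
  have hm' : (0 : ℝ) < m := by exact_mod_cast hm
  have hβ := growthRate_pos hm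
  have hpow := growthRate_pow m
  have h : growthRate (m + 2) + ((4 * (m + 2) : ℕ) : ℝ) / growthRate (m + 2) ^ m =
      ((m : ℝ) + 1) / m * growthRate (m + 2) := by
    rw [pow_succ] at hpow
    field_simp
    push_cast
    linarith
  rw [h, listBound_eq, Nat.cast_add, Nat.cast_one]
  linarith [Nat.lt_floor_add_one (((m : ℝ) + 1) / m * growthRate (m + 2))]

lemma poly_lt_two_pow {m : ℕ} (hm : 10 ≤ m) : 11 * (m + 2) * (m + 1) < 2 ^ (m + 1) := by
  induction m, hm using Nat.le_induction with
  | base => norm_num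
  | succ m hm ih =>
    rw [pow_succ]
    nlinarith

lemma growthRate_lt {m : ℕ} (hm : 10 ≤ m) : growthRate (m + 2) < 2 * m / (m + 1) := by
  have hm' : (0 : ℝ) < m := by exact_mod_cast (by omega : 0 < m)
  refine lt_of_pow_lt_pow_left₀ (m + 1) (by positivity) ?_
  rw [growthRate_pow]
  have hexp : (((m : ℝ) + 1) / m) ^ m < 2.75 := by
    have h1 : ((m : ℝ) + 1) / m ≤ Real.exp (1 / m) := by
      have := Real.add_one_le_exp (1 / (m : ℝ))
      have h2 : ((m : ℝ) + 1) / m = 1 / m + 1 := by field_simp; ring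
      linarith
    calc (((m : ℝ) + 1) / m) ^ m ≤ Real.exp (1 / m) ^ m := by gcongr
      _ = Real.exp 1 := by
        rw [← Real.exp_nat_mul]
        congr 1
        field_simp
      _ < 2.75 := by linarith [Real.exp_one_lt_d9]
  have h2 : (11 : ℝ) * (m + 2) * (m + 1) < 2 ^ (m + 1) := by exact_mod_cast poly_lt_two_pow hm
  rw [div_pow, mul_pow, lt_div_iff₀ (by positivity)]
  rw [div_pow, div_lt_iff₀ (by positivity)] at hexp
  calc (4 : ℝ) * (m + 2) * m * (m + 1) ^ (m + 1)
      = (4 * (m + 2) * (m + 1)) * m * (m + 1) ^ m := by ring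
    _ ≤ (4 * (m + 2) * (m + 1)) * m * (2.75 * m ^ m) := by gcongr
    _ = (11 * (m + 2) * (m + 1)) * m ^ (m + 1) := by ring
    _ < 2 ^ (m + 1) * m ^ (m + 1) := by gcongr

theorem listBound_eq_two {k : ℕ} (hk : 12 ≤ k) : listBound k = 2 := by
  obtain ⟨m, rfl⟩ : ∃ m, k = m + 2 := ⟨k - 2, by omega⟩
  have hm : 10 ≤ m := by omega
  have hm1 : (1 : ℝ) ≤ m := by exact_mod_cast (by omega : 1 ≤ m)
  have hβ : 1 ≤ growthRate (m + 2) := by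
    rw [growthRate, growthRate_base]
    refine Real.one_le_rpow (by nlinarith) (div_nonneg zero_le_one ?_)
    push_cast
    linarith
  have hfloor : ⌊((m : ℝ) + 1) / m * growthRate (m + 2)⌋₊ = 1 := by
    rw [Nat.floor_eq_iff (by positivity)]
    have hlt := growthRate_lt hm
    rw [lt_div_iff₀ (by positivity)] at hlt
    rw [div_mul_eq_mul_div, le_div_iff₀ (by positivity), div_lt_iff₀ (by positivity)]
    push_cast
    constructor <;> nlinarith
  rw [listBound_eq, hfloor]

end LineColoring


namespace LineColoring

section Geometry

variable {d k : ℕ} {𝓟 : Set (EuclideanSpace ℝ (Fin d))}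
  {l m : AffineSubspace ℝ (EuclideanSpace ℝ (Fin d))}

lemma IsLine.eq_of_mem (hl : IsLine l) (hm : IsLine m) {x y : EuclideanSpace ℝ (Fin d)}
    (hxy : x ≠ y) (hxl : x ∈ l) (hyl : y ∈ l) (hxm : x ∈ m) (hym : y ∈ m) : l = m := by
  have key : ∀ {n : AffineSubspace ℝ (EuclideanSpace ℝ (Fin d))}, IsLine n → x ∈ n → y ∈ n →
      Submodule.span ℝ {x -ᵥ y} = n.direction := by
    intro n hn hx hy
    refine Submodule.eq_of_le_of_finrank_eq ?_ ?_
    · rw [Submodule.span_singleton_le_iff_mem]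
      exact AffineSubspace.vsub_mem_direction hx hy
    · rw [hn.2, finrank_span_singleton (vsub_ne_zero.2 hxy)]
  exact AffineSubspace.ext_of_direction_eq ((key hl hxl hyl).symm.trans (key hm hxm hym))
    ⟨x, hxl, hxm⟩

lemma IsTraversal.mem {p : Fin k → 𝓟} (hp : IsTraversal 𝓟 l p) (i : Fin k) :
    (p i : EuclideanSpace ℝ (Fin d)) ∈ l := by
  have : (p i : EuclideanSpace ℝ (Fin d)) ∈ 𝓟 ∩ (l : Set (EuclideanSpace ℝ (Fin d))) :=
    hp.1 ▸ Set.mem_range_self i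
  exact this.2

lemma IsTraversal.exists_eq {p : Fin k → 𝓟} (hp : IsTraversal 𝓟 l p) {x : 𝓟}
    (hx : (x : EuclideanSpace ℝ (Fin d)) ∈ l) : ∃ i, p i = x := by
  have : (x : EuclideanSpace ℝ (Fin d)) ∈
      Set.range (fun i => (p i : EuclideanSpace ℝ (Fin d))) := hp.1 ▸ ⟨x.2, hx⟩
  obtain ⟨i, hi⟩ := this
  exact ⟨i, Subtype.ext hi⟩

lemma IsTraversal.injective {p : Fin k → 𝓟} (hp : IsTraversal 𝓟 l p) :
    Function.Injective p := by
  obtain ⟨a, v, t, hv, ht, hpt⟩ := hp.2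
  intro i j hij
  have h := (hpt i).symm.trans ((congrArg Subtype.val hij).trans (hpt j))
  exact ht.injective (smul_left_injective ℝ hv (add_left_cancel h))

lemma eq_id_of_strictMono {f : Fin k → Fin k} (hf : StrictMono f) : f = id :=
  (hf.range_inj strictMono_id).1 <| by
    rw [(Finite.injective_iff_surjective.1 hf.injective).range_eq, Set.range_id]

lemma eq_rev_of_strictAnti {f : Fin k → Fin k} (hf : StrictAnti f) : f = Fin.rev := by
  have h := eq_id_of_strictMono (f := fun i => (f i).rev) fun i j hij => Fin.rev_lt_rev.2 (hf hij)
  funext i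
  have := congrFun h i
  rw [← Fin.rev_rev (f i)]
  exact congrArg Fin.rev this

/-- A permutation of the positions along a line: the identity or the reversal. -/
def orient (b : Bool) (i : Fin k) : Fin k := if b then i.rev else i

lemma orient_orient (b : Bool) (i : Fin k) : orient b (orient b i) = i := by
  cases b <;> simp [orient]

lemma orient_xor (b b' : Bool) (i : Fin k) : orient b (orient b' i) = orient (xor b b') i := by
  cases b <;> cases b' <;> simp [orient]

lemma orient_injective (b : Bool) : Function.Injective (orient b : Fin k → Fin k) :=
  Function.LeftInverse.injective (orient_orient b)

/-- The traversals of a line agree up to reversal. -/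
lemma IsTraversal.eq_orient {p q : Fin k → 𝓟} (hp : IsTraversal 𝓟 l p) (hq : IsTraversal 𝓟 l q) :
    ∃ b, ∀ i, q i = p (orient b i) := by
  choose f hf using fun i => hp.exists_eq (hq.mem i)
  have hfinj : Function.Injective f := fun i j hij =>
    hq.injective (by rw [← hf i, ← hf j, hij])
  obtain ⟨a, v, t, hv, ht, hpt⟩ := hp.2
  obtain ⟨a', v', t', hv', ht', hqt⟩ := hq.2
  have hvv : 0 < inner ℝ v v := real_inner_self_pos.2 hv
  have key : ∀ i j, (t (f i) - t (f j)) * inner ℝ v v = (t' i - t' j) * inner ℝ v' v := by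
    intro i j
    have h : ∀ i, a + t (f i) • v = a' + t' i • v' := fun i => by
      rw [← hpt, ← hqt, hf]
    have h2 : (t (f i) - t (f j)) • v = (t' i - t' j) • v' := by
      have h3 := congrArg₂ (· - ·) (h i) (h j)
      simpa only [add_sub_add_left_eq_sub, ← sub_smul] using h3
    have := congrArg (fun w => inner ℝ w v) h2
    simpa only [real_inner_smul_left] using this
  rcases lt_trichotomy (inner ℝ v' v) 0 with h | h | h
  · refine ⟨true, fun i => ?_⟩
    have hanti : StrictAnti f := fun i j hij => by
      have h1 := mul_neg_of_pos_of_neg (sub_pos.2 (ht' hij)) h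
      rw [← key] at h1
      exact ht.lt_iff_lt.1 (sub_neg.1 (neg_of_mul_neg_left h1 hvv.le))
    rw [← hf i, eq_rev_of_strictAnti hanti]
    rfl
  · refine ⟨false, fun i => ?_⟩
    have hsub : ∀ i j : Fin k, i = j := fun i j => hfinj <| ht.injective <| sub_eq_zero.1 <| by
      have h1 := key i j
      rw [h, mul_zero] at h1
      exact (mul_eq_zero.1 h1).resolve_right hvv.ne'
    rw [← hf i, hsub (f i) (orient false i)]
  · refine ⟨false, fun i => ?_⟩
    have hmono : StrictMono f := fun i j hij => by
      have h1 := mul_pos (sub_pos.2 (ht' hij)) h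
      rw [← key] at h1
      exact ht.lt_iff_lt.1 (sub_pos.1 (pos_of_mul_pos_left h1 hvv.le))
    rw [← hf i, eq_id_of_strictMono hmono]
    rfl

end Geometry

/-- Two sequences that share exactly one term: any vertex that is constrained by the equality of
their color sequences belongs to a set of `n + 1` vertices whose colors are determined by the
other colors. -/
lemma exists_determined {V C : Type*} {n : ℕ} {p q : Fin (n + 2) → V}
    (hp : Function.Injective p) {a b : Fin (n + 2)} (hab : p a = q b)
    (hpq : ∀ i j, p i = q j → i = a ∧ j = b) {i : Fin (n + 2)} (hi : p i ≠ q i) :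
    ∃ T : Finset V, p i ∈ T ∧ (T : Set V) ⊆ {v | ∃ j, p j ≠ q j ∧ (v = p j ∨ v = q j)} ∧
      T.card = n + 1 ∧ ∀ c c' : V → C, (∀ j, c (p j) = c (q j)) → (∀ j, c' (p j) = c' (q j)) →
        Set.EqOn c c' (↑T)ᶜ → c = c' := by
  classical
  have main : ∀ e, (e = a ∨ e = b) → i ≠ e → ∃ T : Finset V, p i ∈ T ∧
      (T : Set V) ⊆ {v | ∃ j, p j ≠ q j ∧ (v = p j ∨ v = q j)} ∧
      T.card = n + 1 ∧ ∀ c c' : V → C, (∀ j, c (p j) = c (q j)) → (∀ j, c' (p j) = c' (q j)) →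
        Set.EqOn c c' (↑T)ᶜ → c = c' := by
    intro e he hie
    refine ⟨(Finset.univ.erase e).image p, ?_, ?_, ?_, ?_⟩
    · exact Finset.mem_image_of_mem _ (by simpa using hie)
    · intro v hv
      simp only [Finset.coe_image, Set.mem_image, Finset.mem_coe, Finset.mem_erase,
        Finset.mem_univ, and_true] at hv
      obtain ⟨j, hj, rfl⟩ := hv
      refine ⟨j, fun h => hj ?_, Or.inl rfl⟩
      obtain ⟨h1, h2⟩ := hpq j j h
      rcases he with rfl | rfl <;> assumption
    · rw [Finset.card_image_of_injective _ hp, Finset.card_erase_of_mem (Finset.mem_univ _)]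
      simp
    · intro c c' hc hc' hcc'
      funext v
      by_cases hv : v ∈ (Finset.univ.erase e).image p
      · obtain ⟨j, hj, rfl⟩ := Finset.mem_image.1 hv
        rw [hc, hc']
        apply hcc'
        intro hq
        obtain ⟨j', hj', h⟩ := Finset.mem_image.1 (Finset.mem_coe.1 hq)
        obtain ⟨h1, h2⟩ := hpq j' j h
        have hj1 := (Finset.mem_erase.1 hj).1
        have hj2 := (Finset.mem_erase.1 hj').1
        rcases he with rfl | rfl
        · exact hj2 h1
        · exact hj1 h2
      · exact hcc' hv
  by_cases hib : i = b
  · refine main a (Or.inl rfl) fun hia => hi ?_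
    rw [← hia, ← hib] at hab
    exact hab
  · exact main b (Or.inr rfl) hib

section Patterns

variable {d k : ℕ}

/-- `l` and `m` are distinct lines of `𝓛`, traversed by `trav l` and `trav m`, which share a point
of `𝓟`. -/
structure IsCrossing (𝓛 : Set (AffineSubspace ℝ (EuclideanSpace ℝ (Fin d))))
    (𝓟 : Set (EuclideanSpace ℝ (Fin d)))
    (trav : AffineSubspace ℝ (EuclideanSpace ℝ (Fin d)) → Fin k → 𝓟)
    (l m : AffineSubspace ℝ (EuclideanSpace ℝ (Fin d))) : Prop where
  left_mem : l ∈ 𝓛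
  right_mem : m ∈ 𝓛
  ne : l ≠ m
  left_trav : IsTraversal 𝓟 l (trav l)
  right_trav : IsTraversal 𝓟 m (trav m)
  meet : ∃ p : 𝓟, (p : EuclideanSpace ℝ (Fin d)) ∈ l ∧ (p : EuclideanSpace ℝ (Fin d)) ∈ m

variable {𝓛 : Set (AffineSubspace ℝ (EuclideanSpace ℝ (Fin d)))}
  {𝓟 : Set (EuclideanSpace ℝ (Fin d))}
  {trav : AffineSubspace ℝ (EuclideanSpace ℝ (Fin d)) → Fin k → 𝓟}
  {l m : AffineSubspace ℝ (EuclideanSpace ℝ (Fin d))}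

lemma IsCrossing.symm (h : IsCrossing 𝓛 𝓟 trav l m) : IsCrossing 𝓛 𝓟 trav m l where
  left_mem := h.right_mem
  right_mem := h.left_mem
  ne := h.ne.symm
  left_trav := h.right_trav
  right_trav := h.left_trav
  meet := h.meet.imp fun _ hp => hp.symm

lemma IsCrossing.exists_inter (hline : ∀ l ∈ 𝓛, IsLine l) (h : IsCrossing 𝓛 𝓟 trav l m)
    (b : Bool) : ∃ i j, trav l i = trav m (orient b j) ∧
      ∀ i' j', trav l i' = trav m (orient b j') → i' = i ∧ j' = j := by
  obtain ⟨x, hxl, hxm⟩ := h.meet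
  obtain ⟨i, hi⟩ := h.left_trav.exists_eq hxl
  obtain ⟨j, hj⟩ := h.right_trav.exists_eq hxm
  refine ⟨i, orient b j, by rw [orient_orient, hi, hj], fun i' j' h' => ?_⟩
  have hx : trav l i' = x := by
    by_contra hne
    refine h.ne ((hline l h.left_mem).eq_of_mem (hline m h.right_mem)
      (fun h0 => hne (Subtype.ext h0)) (h.left_trav.mem i') hxl ?_ hxm)
    rw [h']
    exact h.right_trav.mem _
  refine ⟨h.left_trav.injective (hx.trans hi.symm), orient_injective b ?_⟩
  rw [orient_orient]
  exact h.right_trav.injective (h'.symm.trans (hx.trans hj.symm))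

/-- The patterns to be avoided: two crossing lines have the same sequence of colors, the second
line being traversed in one of its two directions. -/
def crossingPatterns (C : Type*) {n : ℕ} (hline : ∀ l ∈ 𝓛, IsLine l)
    (trav : AffineSubspace ℝ (EuclideanSpace ℝ (Fin d)) → Fin (n + 2) → 𝓟) :
    PatternFamily (AffineSubspace ℝ (EuclideanSpace ℝ (Fin d)) ×
      AffineSubspace ℝ (EuclideanSpace ℝ (Fin d)) × Bool) 𝓟 C where
  supp e := {v | IsCrossing 𝓛 𝓟 trav e.1 e.2.1 ∧ ∃ i,
    trav e.1 i ≠ trav e.2.1 (orient e.2.2 i) ∧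
      (v = trav e.1 i ∨ v = trav e.2.1 (orient e.2.2 i))}
  Occurs e c := IsCrossing 𝓛 𝓟 trav e.1 e.2.1 ∧
    ∀ i, c (trav e.1 i) = c (trav e.2.1 (orient e.2.2 i))
  finite_supp e := by
    refine ((Set.finite_range (trav e.1)).union (Set.finite_range (trav e.2.1))).subset ?_
    rintro v ⟨-, i, -, rfl | rfl⟩
    · exact Or.inl ⟨_, rfl⟩
    · exact Or.inr ⟨_, rfl⟩
  nonempty_supp := by
    rintro ⟨l, m, b⟩ c ⟨h, -⟩
    obtain ⟨i, j, -, hij⟩ := h.exists_inter hline b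
    obtain ⟨i', hi'⟩ := exists_ne i
    exact ⟨trav l i', h, i', fun h' => hi' (hij i' i' h').1, Or.inl rfl⟩
  congr := by
    rintro ⟨l, m, b⟩ c c' hcc' ⟨h, hc⟩
    refine ⟨h, fun i => ?_⟩
    by_cases hi : trav l i = trav m (orient b i)
    · exact congrArg c' hi
    · rw [← hcc' ⟨h, i, hi, Or.inl rfl⟩, ← hcc' ⟨h, i, hi, Or.inr rfl⟩]
      exact hc i

variable {C : Type*} {n : ℕ} (hline : ∀ l ∈ 𝓛, IsLine l)
  {trav : AffineSubspace ℝ (EuclideanSpace ℝ (Fin d)) → Fin (n + 2) → 𝓟}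

lemma crossingPatterns_swap (l m : AffineSubspace ℝ (EuclideanSpace ℝ (Fin d))) (b : Bool) :
    (crossingPatterns C hline trav).supp (l, m, b) ⊆
        (crossingPatterns C hline trav).supp (m, l, b) ∧
      ∀ c, (crossingPatterns C hline trav).Occurs (l, m, b) c →
        (crossingPatterns C hline trav).Occurs (m, l, b) c := by
  constructor
  · rintro v ⟨h, i, hi, hv⟩
    refine ⟨h.symm, orient b i, ?_, ?_⟩
    · simp only [orient_orient]
      exact hi.symm
    · simp only [orient_orient]
      exact hv.symm
  · rintro c ⟨h, hc⟩
    refine ⟨h.symm, fun i => ?_⟩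
    have := hc (orient b i)
    simp only [orient_orient] at this
    exact this.symm

/-- Up to exchanging the two lines, a constrained vertex lies on the first line. -/
lemma crossingPatterns_cases {v : 𝓟} {l m : AffineSubspace ℝ (EuclideanSpace ℝ (Fin d))}
    {b : Bool} (hv : v ∈ (crossingPatterns C hline trav).supp (l, m, b)) :
    ∃ l' m', IsCrossing 𝓛 𝓟 trav l' m' ∧
      (∃ i, trav l' i ≠ trav m' (orient b i) ∧ v = trav l' i) ∧
      (crossingPatterns C hline trav).supp (l', m', b) ⊆
        (crossingPatterns C hline trav).supp (l, m, b) ∧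
      ∀ c, (crossingPatterns C hline trav).Occurs (l, m, b) c →
        (crossingPatterns C hline trav).Occurs (l', m', b) c := by
  obtain ⟨h, i, hi, hv | hv⟩ := hv
  · exact ⟨l, m, h, ⟨i, hi, hv⟩, subset_rfl, fun _ => id⟩
  · refine ⟨m, l, h.symm, ⟨orient b i, ?_, hv⟩, (crossingPatterns_swap hline m l b).1,
      (crossingPatterns_swap hline l m b).2⟩
    rw [orient_orient]
    exact hi.symm

lemma crossingPatterns_determines {v : 𝓟}
    {e : AffineSubspace ℝ (EuclideanSpace ℝ (Fin d)) ×
      AffineSubspace ℝ (EuclideanSpace ℝ (Fin d)) × Bool}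
    (hv : v ∈ (crossingPatterns C hline trav).supp e) :
    ∃ T : Finset 𝓟, v ∈ T ∧ (T : Set 𝓟) ⊆ (crossingPatterns C hline trav).supp e ∧
      T.card = n + 1 ∧ (crossingPatterns C hline trav).Determines e T := by
  obtain ⟨l, m, b⟩ := e
  obtain ⟨l', m', h, ⟨i, hi, rfl⟩, hsub, hocc⟩ := crossingPatterns_cases hline hv
  obtain ⟨x, y, hxy, huniq⟩ := h.exists_inter hline b
  obtain ⟨T, hiT, hT, hcard, hdet⟩ := exists_determined (C := C)
    (q := fun j => trav m' (orient b j)) h.left_trav.injective hxy huniq hi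
  exact ⟨T, hiT, fun w hw => hsub ⟨h, hT hw⟩, hcard, fun c c' hc hc' =>
    hdet c c' (hocc c hc).2 (hocc c' hc').2⟩

lemma InGeneralPosition.exists_pair (hgen : InGeneralPosition 𝓛) (x : EuclideanSpace ℝ (Fin d)) :
    ∃ f : Bool → AffineSubspace ℝ (EuclideanSpace ℝ (Fin d)), ∀ l ∈ 𝓛, x ∈ l → ∃ s, f s = l := by
  by_cases h1 : ∃ l₁ ∈ 𝓛, x ∈ l₁
  · obtain ⟨l₁, hl₁, hx₁⟩ := h1
    by_cases h2 : ∃ l₂ ∈ 𝓛, x ∈ l₂ ∧ l₁ ≠ l₂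
    · obtain ⟨l₂, hl₂, hx₂, hne⟩ := h2
      refine ⟨fun s => if s then l₁ else l₂, fun l hl hx => ?_⟩
      by_contra hno
      push Not at hno
      exact hgen l₁ hl₁ l₂ hl₂ l hl hne (hno true) (hno false) ⟨x, hx₁, hx₂, hx⟩
    · push Not at h2
      exact ⟨fun _ => l₁, fun l hl hx => ⟨true, h2 l hl hx⟩⟩
  · push Not at h1
    exact ⟨fun _ => ⊤, fun l hl hx => absurd hx (h1 l hl)⟩

/-- The patterns through a vertex can be covered by `4k` patterns, where `k = n + 2`. -/
lemma exists_cover (hgen : InGeneralPosition 𝓛) (v : 𝓟) :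
    ∃ B : Finset (AffineSubspace ℝ (EuclideanSpace ℝ (Fin d)) ×
      AffineSubspace ℝ (EuclideanSpace ℝ (Fin d)) × Bool), B.card ≤ 4 * (n + 2) ∧
      ∀ e, v ∈ (crossingPatterns C hline trav).supp e →
        ∃ e' ∈ B, v ∈ (crossingPatterns C hline trav).supp e' ∧
          (crossingPatterns C hline trav).supp e' ⊆ (crossingPatterns C hline trav).supp e ∧
          ∀ c, (crossingPatterns C hline trav).Occurs e c →
            (crossingPatterns C hline trav).Occurs e' c := by
  classical
  obtain ⟨f, hf⟩ := hgen.exists_pair (v : EuclideanSpace ℝ (Fin d))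
  have hpartner : ∀ (l : AffineSubspace ℝ (EuclideanSpace ℝ (Fin d))) (i : Fin (n + 2)),
      ∃ m₀, ∀ m, IsCrossing 𝓛 𝓟 trav l m → (trav l i : EuclideanSpace ℝ (Fin d)) ∈ m →
        m₀ = m := by
    intro l i
    by_cases h : ∃ m, IsCrossing 𝓛 𝓟 trav l m ∧ (trav l i : EuclideanSpace ℝ (Fin d)) ∈ m
    · obtain ⟨m₀, h₀, hi₀⟩ := h
      refine ⟨m₀, fun m hm hi => ?_⟩
      by_contra hne
      exact hgen l h₀.left_mem m₀ h₀.right_mem m hm.right_mem h₀.ne hm.ne hne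
        ⟨trav l i, h₀.left_trav.mem i, hi₀, hi⟩
    · exact ⟨⊤, fun m hm hi => absurd ⟨m, hm, hi⟩ h⟩
  choose partner hpartner using hpartner
  refine ⟨Finset.univ.image fun x : Bool × Fin (n + 2) × Bool =>
    (f x.1, partner (f x.1) x.2.1, x.2.2), ?_, ?_⟩
  · refine Finset.card_image_le.trans ?_
    simp
    omega
  · rintro ⟨l, m, b⟩ hv
    obtain ⟨l', m', h, ⟨i, hi, hvi⟩, hsub, hocc⟩ := crossingPatterns_cases hline hv
    refine ⟨(l', m', b), ?_, ⟨h, i, hi, Or.inl hvi⟩, hsub, hocc⟩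
    obtain ⟨s, rfl⟩ := hf l' h.left_mem (hvi ▸ h.left_trav.mem i)
    obtain ⟨x, hxl, hxm⟩ := h.meet
    obtain ⟨j, rfl⟩ := h.left_trav.exists_eq hxl
    exact Finset.mem_image.2 ⟨(s, j, b), Finset.mem_univ _,
      by simp only [hpartner _ _ _ h hxm]⟩

end Patterns

end LineColoring

theorem corollary4p10 {d : ℕ} {C : Type*} (k : ℕ) (hk : 3 ≤ k)
    (𝓛 : Set (AffineSubspace ℝ (EuclideanSpace ℝ (Fin d))))
    (hline : ∀ l ∈ 𝓛, LineColoring.IsLine l)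
    (hgen : LineColoring.InGeneralPosition 𝓛)
    (𝓟 : Set (EuclideanSpace ℝ (Fin d)))
    (hpoints : ∀ l ∈ 𝓛, (𝓟 ∩ (l : Set (EuclideanSpace ℝ (Fin d)))).ncard = k)
    (L : 𝓟 → Set C)
    (hL : ∀ p : 𝓟, (LineColoring.listBound k : ℕ∞) ≤ (L p).encard) :
    (∃ c : 𝓟 → C, (∀ p : 𝓟, c p ∈ L p) ∧
      ∀ l ∈ 𝓛, ∀ m ∈ 𝓛, l ≠ m → (∃ p : 𝓟, (p : EuclideanSpace ℝ (Fin d)) ∈ l ∧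
          (p : EuclideanSpace ℝ (Fin d)) ∈ m) →
        ¬ LineColoring.SameColorSequence k 𝓟 c l m) ∧
    (12 ≤ k → LineColoring.listBound k = 2) := by
  classical
  refine ⟨?_, LineColoring.listBound_eq_two⟩
  obtain ⟨n, rfl⟩ : ∃ n, k = n + 2 := ⟨k - 2, by omega⟩
  have hn : 1 ≤ n := by omega
  have hlist : ∀ p : 𝓟, ∃ t : Finset C, (t : Set C) ⊆ L p ∧
      t.card = LineColoring.listBound (n + 2) := by
    intro p
    obtain ⟨t, ht, hcard⟩ := Set.exists_subset_encard_eq (hL p)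
    have hfin : t.Finite := Set.finite_of_encard_eq_coe hcard
    refine ⟨hfin.toFinset, by simpa using ht, ?_⟩
    rw [hfin.encard_eq_coe_toFinset_card] at hcard
    exact_mod_cast hcard
  choose L' hL' hcard using hlist
  rcases 𝓟.eq_empty_or_nonempty with h𝓟 | ⟨x₀, hx₀⟩
  · subst h𝓟
    exact ⟨fun p => p.2.elim, fun p => p.2.elim, fun l _ m _ _ ⟨p, _⟩ => p.2.elim⟩
  have htrav : ∀ l : AffineSubspace ℝ (EuclideanSpace ℝ (Fin d)), ∃ p : Fin (n + 2) → 𝓟,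
      (∃ q : Fin (n + 2) → 𝓟, LineColoring.IsTraversal 𝓟 l q) →
        LineColoring.IsTraversal 𝓟 l p := by
    intro l
    by_cases h : ∃ q : Fin (n + 2) → 𝓟, LineColoring.IsTraversal 𝓟 l q
    · obtain ⟨q, hq⟩ := h
      exact ⟨q, fun _ => hq⟩
    · exact ⟨fun _ => ⟨x₀, hx₀⟩, fun h' => absurd h' h⟩
  choose trav htrav using htrav
  choose B hB hcover using LineColoring.exists_cover (C := C) (trav := trav) hline hgen
  obtain ⟨c, hcL, hc⟩ := (LineColoring.crossingPatterns C hline trav).exists_listColoring L' B n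
    (4 * (n + 2)) _ _ (LineColoring.growthRate_pos hn) hcard hB
    (LineColoring.growthRate_add_le_listBound hn) (fun e v => hcover v e)
    (fun e v => LineColoring.crossingPatterns_determines hline)
  refine ⟨c, fun p => hL' p (hcL p), ?_⟩
  rintro l hl m hm hne hmeet ⟨p, q, hp, hq, hpq⟩
  have hl' := htrav l ⟨p, hp⟩
  have hm' := htrav m ⟨q, hq⟩
  obtain ⟨b, hb⟩ := hl'.eq_orient hp
  obtain ⟨b', hb'⟩ := hm'.eq_orient hq
  refine hc (l, m, xor b' b) ⟨⟨hl, hm, hne, hl', hm', hmeet⟩, fun i => ?_⟩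
  have h := hpq (LineColoring.orient b i)
  rw [hb, hb', LineColoring.orient_orient, LineColoring.orient_xor] at h
  exact h
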